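/- Let $\mathbb V=\mathbb R^n$ or $\mathbb V=\mathbb C^n$, let $A_1,\dots,A_m$ be symmetric (respectively Hermitian) $n\times n$ matrices, $v_1,\dots,v_m\in\mathbb V$ and $f^0\in\mathbb R^m$, and let $f:\mathbb V\to\mathbb R^m$ be the quadratic map $$f_i(x)=x^*A_ix-v_i^*x-x^*v_i+f^0_i,\qquad i=1,\dots,m.$$ For $c\in\mathbb R^m$ write $c\cdot A=\sum_i c_iA_i$ and $c\cdot(v-Ax_0)=\sum_i c_i(v_i-A_ix_0)$. For a positive definite (symmetric, respectively Hermitian) matrix $A_+$ put $|x|_+^2=x^*A_+x$, and let $\lambda^+_{\min}(M)$ be the smallest $\lambda\in\mathbb R$ such that $(M-\lambda A_+)x=0$ for some $x\ne0$. For $x_0\in\mathbb V$ define $$\varepsilon_{\max}^2(x_0,A_+)=\lim_{\epsilon\to0^+}\ \min_{c\in\mathcal C}\Big|\big(c\cdot A-\lambda^+_{\min}(c\cdot A)A_++\epsilon I\big)^{-1}\,c\cdot(v-Ax_0)\Big|_+^2,\qquad \mathcal C=\{c\in\mathbb R^m:\ |c|^2=1,\ \lambda^+_{\min}(c\cdot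 A)\le0\}.$$ If $\varepsilon_{\max}(x_0,A_+)=\infty$ for some point $x_0\in\mathbb V$ and some positive definite $A_+$, then the full image $\{f(x):x\in\mathbb V\}\subseteq\mathbb R^m$ is convex. -/

import Mathlib

open scoped ComplexOrder Matrix Topology ENNReal

noncomputable section

namespace QuadImage

variable {𝕜 : Type*} [RCLike 𝕜] {n m : ℕ}

/-- The quadratic map `f_i(x) = x* A_i x - v_i* x - x* v_i + f⁰_i` from `𝕜ⁿ` to `ℝᵐ`.
The expression inside `RCLike.re` is real when `A_i` is Hermitian. -/
def quadMap (A : Fin m → Matrix (Fin n) (Fin n) 𝕜) (v : Fin m → Fin n → 𝕜) (f₀ : Fin m → ℝ)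
    (x : Fin n → 𝕜) : Fin m → ℝ :=
  fun i => RCLike.re (star x ⬝ᵥ (A i *ᵥ x) - star (v i) ⬝ᵥ x - star x ⬝ᵥ v i) + f₀ i

/-- The combination `c · A = ∑ c_i A_i`. -/
def combMat (c : Fin m → ℝ) (A : Fin m → Matrix (Fin n) (Fin n) 𝕜) : Matrix (Fin n) (Fin n) 𝕜 :=
  ∑ i, c i • A i

/-- The vector `c · (v - A x₀) = ∑ c_i (v_i - A_i x₀)`. -/
def combVec (c : Fin m → ℝ) (A : Fin m → Matrix (Fin n) (Fin n) 𝕜) (v : Fin m → Fin n → 𝕜)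
    (x₀ : Fin n → 𝕜) : Fin n → 𝕜 :=
  ∑ i, c i • (v i - A i *ᵥ x₀)

/-- `|x|₊² = x* A₊ x`. -/
def plusNormSq (Aplus : Matrix (Fin n) (Fin n) 𝕜) (x : Fin n → 𝕜) : ℝ :=
  RCLike.re (star x ⬝ᵥ (Aplus *ᵥ x))

/-- The generalized eigenvalues of `M` with respect to `A₊` (all of them are real when `M` is
Hermitian and `A₊` is positive definite). -/
def genEigenvalues (Aplus M : Matrix (Fin n) (Fin n) 𝕜) : Set ℝ :=
  {l : ℝ | ∃ x : Fin n → 𝕜, x ≠ 0 ∧ (M - l • Aplus) *ᵥ x = 0}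

/-- The smallest generalized eigenvalue `λ⁺_min(M)`. For `n ≥ 1`, Hermitian `M` and `A₊ ≻ 0`
the set of generalized eigenvalues is finite and nonempty, so the infimum is a minimum. -/
def lamMin (Aplus M : Matrix (Fin n) (Fin n) 𝕜) : ℝ :=
  sInf (genEigenvalues Aplus M)

/-- The set `𝒞` of unit vectors `c ∈ ℝᵐ` with `λ⁺_min(c · A) ≤ 0`. -/
def admissible (A : Fin m → Matrix (Fin n) (Fin n) 𝕜) (Aplus : Matrix (Fin n) (Fin n) 𝕜) :
    Set (Fin m → ℝ) :=
  {c | c ⬝ᵥ c = 1 ∧ lamMin Aplus (combMat c A) ≤ 0}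

/-- `|(c·A - λ⁺_min(c·A) A₊ + ε)⁻¹ c·(v - A x₀)|₊²`, where `ε` stands for `ε` times the identity.
For `ε > 0` the inverted matrix is positive definite, hence invertible. -/
def resolventNormSq (A : Fin m → Matrix (Fin n) (Fin n) 𝕜) (v : Fin m → Fin n → 𝕜)
    (x₀ : Fin n → 𝕜) (Aplus : Matrix (Fin n) (Fin n) 𝕜) (ε : ℝ) (c : Fin m → ℝ) : ℝ :=
  plusNormSq Aplus
    ((combMat c A - lamMin Aplus (combMat c A) • Aplus +
        ε • (1 : Matrix (Fin n) (Fin n) 𝕜))⁻¹ *ᵥ combVec c A v x₀)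

/-- The minimum of `resolventNormSq` over `c ∈ 𝒞`, in `[0, ∞]`. -/
def minResolventNormSq (A : Fin m → Matrix (Fin n) (Fin n) 𝕜) (v : Fin m → Fin n → 𝕜)
    (x₀ : Fin n → 𝕜) (Aplus : Matrix (Fin n) (Fin n) 𝕜) (ε : ℝ) : ℝ≥0∞ :=
  ⨅ c ∈ admissible A Aplus, ENNReal.ofReal (resolventNormSq A v x₀ Aplus ε c)

/-- `ε²_max(x₀, A₊)`, the limit of the minimum over `𝒞` as `ε → 0⁺`, exists in `[0, ∞]` and
equals `L`. -/
def HasEpsMaxSq (A : Fin m → Matrix (Fin n) (Fin n) 𝕜) (v : Fin m → Fin n → 𝕜)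
    (x₀ : Fin n → 𝕜) (Aplus : Matrix (Fin n) (Fin n) 𝕜) (L : ℝ≥0∞) : Prop :=
  Filter.Tendsto (minResolventNormSq A v x₀ Aplus) (𝓝[>] (0 : ℝ)) (𝓝 L)

end QuadImage

end

/-! Translate to `x₀` and fix a ball `|y|₊² ≤ ρ`. For a unit vector `c`, the function `c · f(x₀ +
y)` is, up to a constant, `y* M y - 2 Re y* b` with `M = c·A` and `b = c·(v - A x₀)`. Its minimizer
over the ball is unique. If `λ⁺_min(M) > 0`, the function is strictly convex. If `λ⁺_min(M) ≤ 0`,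
put `N = M - λ⁺_min(M) A₊ ⪰ 0`: were `b` orthogonal to `ker N`, then `b = N w`, and the resolvents
`(N + ε)⁻¹ b` would stay bounded as `ε → 0⁺`, against `ε_max = ∞`
(`exists_kernel_of_hasEpsMaxSq_top`). So some kernel vector of `N` meets `b`; moving along it out to
the sphere lowers the function, and this forces uniqueness (`eq_of_isMinOn`).

Unique minimizers in every direction make the image of the ball convex
(`convex_image_of_unique_minimizers`). They depend continuously on `c`, so their radial extension
`G` is continuous, and a Brouwer-type theorem solves `F (G x) = p` for each `p` strictly inside all
supporting half-spaces. The radius is arbitrary, so any two points of the full image lie in the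
image of a common ball. -/

namespace QuadImage

/-! ### Brouwer-type zero theorem, by an analytic no-retraction argument. -/

section Brouwer

open MeasureTheory Metric Set

/-- The determinant of `1 + t N` is a polynomial in `t` of degree at most `dim E`. -/
theorem exists_polynomial_eval_eq_det_one_add_smul {E : Type*} [AddCommGroup E] [Module ℝ E]
    [FiniteDimensional ℝ E] (N : E →ₗ[ℝ] E) :
    ∃ p : Polynomial ℝ, p.natDegree ≤ Module.finrank ℝ E ∧
      ∀ t : ℝ, p.eval t = LinearMap.det (LinearMap.id + t • N) := by
  let b := Module.finBasis ℝ E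
  let M := LinearMap.toMatrix b b N
  refine ⟨Matrix.det ((Polynomial.X : Polynomial ℝ) • M.map Polynomial.C +
    (1 : Matrix _ _ ℝ).map Polynomial.C), ?_, fun t => ?_⟩
  · simpa using Polynomial.natDegree_det_X_add_C_le M 1
  · rw [← LinearMap.det_toMatrix b, ← Polynomial.coe_evalRingHom, RingHom.map_det]
    congr 1
    ext i j
    by_cases h : i = j
    · subst h
      simp [M, Polynomial.eval_add]
      ring
    · simp [M, h]
      ring

/-- Integrals of `det (1 + t N x)` over `x` are polynomial in `t`, so if they are equal to a
constant for all small `t > 0`, they are equal to it for all `t`. -/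
theorem integral_det_one_add_smul_eq_of_forall_small {E X : Type*} [NormedAddCommGroup E]
    [NormedSpace ℝ E] [FiniteDimensional ℝ E] [MeasurableSpace X] {μ : Measure X}
    (N : X → E →L[ℝ] E) {V t₀ : ℝ} (ht₀ : 0 < t₀)
    (hint : ∀ t : ℝ, Integrable (fun x => (ContinuousLinearMap.id ℝ E + t • N x).det) μ)
    (hV : ∀ t ∈ Ioo 0 t₀, ∫ x, (ContinuousLinearMap.id ℝ E + t • N x).det ∂μ = V) (t : ℝ) :
    ∫ x, (ContinuousLinearMap.id ℝ E + t • N x).det ∂μ = V := by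
  -- One node more than the degree bound: the determinant at `t` is then a combination of its values
  -- at the nodes, with Lagrange weights that do not depend on `x`.
  obtain ⟨s, hs, hcard⟩ := (Ioo_infinite ht₀).exists_subset_card_eq (Module.finrank ℝ E + 1)
  have hinj : Set.InjOn (id : ℝ → ℝ) (s : Set ℝ) := Function.injective_id.injOn
  have hne : s.Nonempty := by
    rw [← Finset.card_pos]; omega
  have key : ∀ x, (ContinuousLinearMap.id ℝ E + t • N x).det =
      ∑ u ∈ s, (ContinuousLinearMap.id ℝ E + u • N x).det *
        (Lagrange.basis s id u).eval t := by
    intro x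
    obtain ⟨p, hp, hpe⟩ := exists_polynomial_eval_eq_det_one_add_smul (N x : E →ₗ[ℝ] E)
    have hdeg : p.degree < s.card := by
      refine lt_of_le_of_lt p.degree_le_natDegree ?_
      rw [hcard]
      exact_mod_cast Nat.lt_succ_of_le hp
    have h1 := congrArg (Polynomial.eval t) (Lagrange.eq_interpolate hinj hdeg)
    rw [Lagrange.interpolate_apply, Polynomial.eval_finsetSum] at h1
    simp only [Polynomial.eval_mul, Polynomial.eval_C, id, hpe] at h1
    exact h1
  simp_rw [key]
  rw [integral_finsetSum _ fun u _ => (hint u).mul_const _]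
  simp_rw [integral_mul_const]
  rw [Finset.sum_congr rfl fun u hu => by rw [hV u (hs hu)], ← Finset.mul_sum,
    ← Polynomial.eval_finsetSum, Lagrange.sum_basis hinj hne]
  simp

variable {E : Type*} [NormedAddCommGroup E] [InnerProductSpace ℝ E] [FiniteDimensional ℝ E]

/-- The differential of a map with values in the unit sphere is degenerate. -/
theorem det_fderiv_eq_zero_of_norm_eq_one {r : E → E} (hr : Differentiable ℝ r)
    (hnorm : ∀ x, ‖r x‖ = 1) (x : E) : (fderiv ℝ r x).det = 0 := by
  by_contra hdet
  have hbij : Function.Surjective (fderiv ℝ r x) := by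
    have := ((fderiv ℝ r x : E →ₗ[ℝ] E).equivOfDetNeZero hdet).surjective
    intro y
    obtain ⟨z, hz⟩ := this y
    exact ⟨z, hz⟩
  -- Differentiating `|r|² = 1` along a `w` with `r'(x) w = r x` would give `2 |r x|² = 0`.
  obtain ⟨w, hw⟩ := hbij (r x)
  have h1 : HasFDerivAt (fun y => inner ℝ (r y) (r y)) _ x :=
    (hr x).hasFDerivAt.inner ℝ (hr x).hasFDerivAt
  have h2 : (fun y => inner ℝ (r y) (r y)) = fun _ => (1 : ℝ) := by
    funext y
    rw [real_inner_self_eq_norm_sq, hnorm]; norm_num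
  rw [h2] at h1
  have h3 := congrArg (fun L => L w) (h1.unique (hasFDerivAt_const (1 : ℝ) x))
  simp [hw, hnorm] at h3

/-- There is no Lipschitz `C¹` map of the space to the unit sphere which is radial outside
the unit ball. -/
theorem not_exists_contDiff_retraction [MeasurableSpace E] [BorelSpace E] {r : E → E} {K : NNReal}
    (hr : ContDiff ℝ 1 r) (hK : LipschitzWith K r) (hnorm : ∀ x, ‖r x‖ = 1)
    (hout : ∀ x, 1 ≤ ‖x‖ → r x = ‖x‖⁻¹ • x) : False := by
  have hdiff : Differentiable ℝ r := hr.differentiable one_ne_zero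
  have hfc : Continuous (fderiv ℝ r) := hr.continuous_fderiv one_ne_zero
  -- `id + t N` is the derivative of the homotopy `x + t (r x - x)` from the identity to `r`.
  let N : E → E →L[ℝ] E := fun x => fderiv ℝ r x - ContinuousLinearMap.id ℝ E
  have hNc : Continuous N := hfc.sub continuous_const
  have hNb : ∀ x, ‖N x‖ ≤ K + 1 := fun x =>
    (norm_sub_le _ _).trans (add_le_add (norm_fderiv_le_of_lipschitz ℝ hK)
      ContinuousLinearMap.norm_id_le)
  have hcont : ∀ t : ℝ, Continuous fun x => (ContinuousLinearMap.id ℝ E + t • N x).det :=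
    fun t => ContinuousLinearMap.continuous_det.comp
      (continuous_const.add (hNc.const_smul t))
  have hLip : LipschitzWith (K + 1) fun x => r x - x := hK.sub LipschitzWith.id
  obtain ⟨δ, hδ, hdet⟩ : ∃ δ > 0, ∀ L : E →L[ℝ] E,
      dist L (ContinuousLinearMap.id ℝ E) < δ → 0 < L.det := by
    have h1 : (0 : ℝ) < (ContinuousLinearMap.id ℝ E).det := by
      simp [ContinuousLinearMap.det]
    exact Metric.eventually_nhds_iff.1
      ((ContinuousLinearMap.continuous_det (E := E) (𝕜 := ℝ)).continuousAt.eventually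
        (lt_mem_nhds h1))
  have hK1 : (0 : ℝ) < K + 1 := by positivity
  -- The first bound keeps the Jacobian positive; the second makes `t (r - id)` a contraction, so
  -- that the homotopy map is bijective.
  set t₀ : ℝ := min (δ / (K + 1)) (1 / (K + 1)) with ht₀def
  have ht₀ : 0 < t₀ := lt_min (by positivity) (by positivity)
  have hsmall : ∀ t ∈ Ioo 0 t₀,
      ∫ x in closedBall (0 : E) 1, (ContinuousLinearMap.id ℝ E + t • N x).det =
        volume.real (closedBall (0 : E) 1) := by
    rintro t ⟨ht, htt⟩
    have htδ : t * (K + 1) < δ := by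
      have := htt.trans_le (min_le_left _ _)
      rwa [lt_div_iff₀ hK1] at this
    have ht1 : t * (K + 1) < 1 := by
      have := htt.trans_le (min_le_right _ _)
      rwa [lt_div_iff₀ hK1] at this
    have htlt : t < 1 := by nlinarith [K.coe_nonneg]
    let g : E → E := fun x => x + t • (r x - x)
    have hg' : ∀ x, HasFDerivAt g (ContinuousLinearMap.id ℝ E + t • N x) x := fun x =>
      (hasFDerivAt_id x).add (((hdiff x).hasFDerivAt.sub (hasFDerivAt_id x)).const_smul t)
    have hpos : ∀ x, 0 < (ContinuousLinearMap.id ℝ E + t • N x).det := fun x => by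
      refine hdet _ ?_
      rw [dist_eq_norm, add_sub_cancel_left, norm_smul, Real.norm_of_nonneg ht.le]
      exact (mul_le_mul_of_nonneg_left (hNb x) ht.le).trans_lt htδ
    have happ : ApproximatesLinearOn g
        ((ContinuousLinearEquiv.refl ℝ E : E ≃L[ℝ] E) : E →L[ℝ] E) univ
        (Real.toNNReal t * (K + 1)) := by
      intro x _ y _
      have h1 : g x - g y - ((ContinuousLinearEquiv.refl ℝ E : E ≃L[ℝ] E) : E →L[ℝ] E) (x - y) =
          t • ((r x - x) - (r y - y)) := by
        simp only [g, ContinuousLinearEquiv.coe_refl, ContinuousLinearMap.coe_id', id]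
        module
      rw [h1, norm_smul, Real.norm_of_nonneg ht.le]
      have h2 := hLip.dist_le_mul x y
      rw [dist_eq_norm, dist_eq_norm] at h2
      push_cast at h2 ⊢
      rw [Real.coe_toNNReal _ ht.le, mul_assoc]
      exact mul_le_mul_of_nonneg_left h2 ht.le
    have hc : Subsingleton E ∨ Real.toNNReal t * (K + 1) <
        ‖((ContinuousLinearEquiv.refl ℝ E).symm : E →L[ℝ] E)‖₊⁻¹ := by
      rcases subsingleton_or_nontrivial E with h | h
      · exact Or.inl h
      · right
        have hid : ‖((ContinuousLinearEquiv.refl ℝ E).symm : E →L[ℝ] E)‖₊ = 1 :=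
          ContinuousLinearMap.nnnorm_id
        rw [hid, inv_one, ← NNReal.coe_lt_coe]
        push_cast
        rwa [Real.coe_toNNReal _ ht.le]
    have hinj : Function.Injective g := by
      have := happ.injective hc
      intro x y hxy
      have h := @this ⟨x, trivial⟩ ⟨y, trivial⟩ hxy
      exact congrArg Subtype.val h
    have hsurj : Function.Surjective g := happ.surjective hc
    -- The ball is preserved by convexity. A point outside is moved radially to norm `(1 - t) ‖x‖ +
    -- t > 1`, so every point of the ball has its preimage in the ball.
    have himg : g '' closedBall (0 : E) 1 = closedBall (0 : E) 1 := by
      apply Subset.antisymm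
      · rintro _ ⟨x, hx, rfl⟩
        rw [mem_closedBall_zero_iff] at hx ⊢
        have h1 : g x = (1 - t) • x + t • r x := by simp only [g]; module
        rw [h1]
        calc ‖(1 - t) • x + t • r x‖ ≤ ‖(1 - t) • x‖ + ‖t • r x‖ := norm_add_le _ _
          _ = (1 - t) * ‖x‖ + t * 1 := by
            rw [norm_smul, norm_smul, hnorm, Real.norm_of_nonneg ht.le,
              Real.norm_of_nonneg (by linarith)]
          _ ≤ 1 := by nlinarith
      · intro y hy
        obtain ⟨x, rfl⟩ := hsurj y
        refine ⟨x, ?_, rfl⟩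
        rw [mem_closedBall_zero_iff] at hy ⊢
        by_contra! hx
        have hx0 : 0 < ‖x‖ := by linarith
        have h1 : g x = ((1 - t) + t * ‖x‖⁻¹) • x := by
          simp only [g, hout x hx.le]; module
        rw [h1, norm_smul, Real.norm_of_nonneg (by
          have : 0 ≤ t * ‖x‖⁻¹ := by positivity
          linarith), add_mul, mul_assoc, inv_mul_cancel₀ hx0.ne'] at hy
        nlinarith
    have hcv := integral_image_eq_integral_abs_det_fderiv_smul volume
      (measurableSet_closedBall (x := (0 : E)) (ε := 1)) (fun x _ => (hg' x).hasFDerivWithinAt)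
      hinj.injOn (fun _ => (1 : ℝ))
    rw [himg] at hcv
    simp only [integral_const, smul_eq_mul, mul_one, measureReal_restrict_apply_univ,
      abs_of_pos (hpos _)] at hcv
    exact hcv.symm
  -- At `t = 1` the integrand is `det r' = 0`, yet the integral still equals the volume of the ball.
  have hone := integral_det_one_add_smul_eq_of_forall_small N ht₀
    (fun t => (hcont t).continuousOn.integrableOn_compact (isCompact_closedBall (0 : E) 1))
    hsmall 1
  simp only [N, one_smul, add_sub_cancel, det_fderiv_eq_zero_of_norm_eq_one hdiff hnorm,
    integral_zero] at hone
  have hvol : 0 < volume.real (closedBall (0 : E) 1) :=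
    ENNReal.toReal_pos (measure_closedBall_pos volume (0 : E) one_pos).ne'
      measure_closedBall_lt_top.ne
  exact hvol.ne hone

/-- Away from the origin, normalization is Lipschitz; this turns a nonvanishing Lipschitz map into a
sphere-valued Lipschitz one. -/
theorem norm_normalize_sub_normalize_le {V : Type*} [NormedAddCommGroup V] [NormedSpace ℝ V]
    {a b : V} {δ : ℝ} (hδ : 0 < δ) (ha : δ ≤ ‖a‖) (hb : δ ≤ ‖b‖) :
    ‖‖a‖⁻¹ • a - ‖b‖⁻¹ • b‖ ≤ 2 / δ * ‖a - b‖ := by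
  have ha0 : 0 < ‖a‖ := hδ.trans_le ha
  have hb0 : 0 < ‖b‖ := hδ.trans_le hb
  have h1 : ‖a‖⁻¹ • a - ‖b‖⁻¹ • b = ‖a‖⁻¹ • (a - b) + (‖a‖⁻¹ - ‖b‖⁻¹) • b := by module
  have h2 : |‖a‖⁻¹ - ‖b‖⁻¹| * ‖b‖ = ‖a‖⁻¹ * |‖b‖ - ‖a‖| := by
    have : ‖a‖⁻¹ - ‖b‖⁻¹ = ‖a‖⁻¹ * (‖b‖ - ‖a‖) * ‖b‖⁻¹ := by field_simp
    rw [this, abs_mul, abs_mul, abs_of_pos (inv_pos.2 ha0), abs_of_pos (inv_pos.2 hb0)]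
    field_simp
  have h3 : |‖b‖ - ‖a‖| ≤ ‖a - b‖ := by
    rw [abs_sub_comm]; exact abs_norm_sub_norm_le a b
  have h4 : ‖a‖⁻¹ ≤ δ⁻¹ := inv_anti₀ hδ ha
  calc ‖‖a‖⁻¹ • a - ‖b‖⁻¹ • b‖ ≤ ‖‖a‖⁻¹ • (a - b)‖ + ‖(‖a‖⁻¹ - ‖b‖⁻¹) • b‖ := by
        rw [h1]; exact norm_add_le _ _
    _ = ‖a‖⁻¹ * ‖a - b‖ + ‖a‖⁻¹ * |‖b‖ - ‖a‖| := by
        rw [norm_smul, norm_smul, Real.norm_of_nonneg (inv_pos.2 ha0).le, Real.norm_eq_abs, h2]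
    _ ≤ δ⁻¹ * ‖a - b‖ + δ⁻¹ * ‖a - b‖ := by gcongr
    _ = 2 / δ * ‖a - b‖ := by ring

/-- A continuous map of the space which is the identity far away from the origin has a zero. -/
theorem exists_eq_zero_of_eq_id_outside {φ : E → E} (hφ : Continuous φ) {R : ℝ} (hR : 0 < R)
    (hout : ∀ x, R ≤ ‖x‖ → φ x = x) : ∃ x, φ x = 0 := by
  by_contra! hne
  borelize E
  obtain ⟨δ, hδ, hδφ⟩ : ∃ δ > 0, ∀ x, δ ≤ ‖φ x‖ := by
    obtain ⟨z, -, hz⟩ := (isCompact_closedBall (0 : E) R).exists_isMinOn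
      ⟨0, by simp [hR.le]⟩ hφ.norm.continuousOn
    refine ⟨min ‖φ z‖ R, lt_min (norm_pos_iff.2 (hne z)) hR, fun x => ?_⟩
    rcases le_total ‖x‖ R with h | h
    · exact (min_le_left _ _).trans (hz (by simpa using h))
    · rw [hout x h]; exact (min_le_right _ _).trans h
  -- Smoothing `φ - id` rather than `φ`, with no growth of support, leaves the perturbed map equal
  -- to the identity far away. The error `δ / 2` keeps it nonvanishing.
  obtain ⟨g, hg, hgd, hgs⟩ := (hφ.sub continuous_id).exists_contDiff_approx 1
    (continuous_const (y := δ / 2)) (fun _ => half_pos hδ)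
  have hg0 : ∀ x, R ≤ ‖x‖ → g x = 0 := fun x hx => by
    by_contra h
    exact hgs h (by simp [hout x hx])
  have hgc : HasCompactSupport g :=
    HasCompactSupport.intro (isCompact_closedBall (0 : E) R) fun x hx => hg0 x (by
      simp only [mem_closedBall_zero_iff, not_le] at hx
      exact hx.le)
  obtain ⟨K, hK⟩ := hg.lipschitzWith_of_hasCompactSupport hgc one_ne_zero
  -- The factor `R` rescales the region of modification into the unit ball.
  let ψ : E → E := fun x => R • x + g (R • x)
  have hψ : ContDiff ℝ 1 ψ := by
    have h : ContDiff ℝ 1 fun x : E => R • x := contDiff_const.smul contDiff_id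
    exact h.add (hg.comp h)
  have hψL : LipschitzWith ((1 + K) * Real.toNNReal R) ψ := by
    refine (LipschitzWith.id.add hK).comp (g := fun x : E => R • x)
      (LipschitzWith.of_dist_le_mul fun x y => ?_)
    rw [dist_smul₀, Real.coe_toNNReal _ hR.le, Real.norm_of_nonneg hR.le]
  have hψδ : ∀ x, δ / 2 ≤ ‖ψ x‖ := fun x => by
    have h1 := hgd (R • x)
    have h2 := hδφ (R • x)
    have h3 : φ (R • x) = ψ x - (g (R • x) - (φ (R • x) - R • x)) := by
      simp only [ψ]; abel
    have h4 : ‖φ (R • x)‖ ≤ ‖ψ x‖ + ‖g (R • x) - (φ (R • x) - R • x)‖ := by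
      conv_lhs => rw [h3]
      exact norm_sub_le _ _
    rw [dist_eq_norm] at h1
    have h5 : ‖g (R • x) - (φ (R • x) - R • x)‖ < δ / 2 := h1
    linarith
  have hψ0 : ∀ x, ψ x ≠ 0 := fun x h => by
    have := hψδ x
    rw [h, norm_zero] at this
    linarith
  refine not_exists_contDiff_retraction (r := fun x => ‖ψ x‖⁻¹ • ψ x)
    (K := Real.toNNReal (2 / (δ / 2)) * ((1 + K) * Real.toNNReal R)) ?_ ?_ ?_ ?_
  · exact ((hψ.norm ℝ hψ0).inv fun x => norm_ne_zero_iff.2 (hψ0 x)).smul hψ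
  · refine LipschitzWith.of_dist_le_mul fun x y => ?_
    have h1 := norm_normalize_sub_normalize_le (half_pos hδ) (hψδ x) (hψδ y)
    have h2 := hψL.dist_le_mul x y
    rw [dist_eq_norm] at h2 ⊢
    refine h1.trans ?_
    rw [NNReal.coe_mul, Real.coe_toNNReal _ (by positivity), mul_assoc]
    exact mul_le_mul_of_nonneg_left h2 (by positivity)
  · intro x
    rw [norm_smul, norm_inv, norm_norm, inv_mul_cancel₀ (norm_ne_zero_iff.2 (hψ0 x))]
  · intro x hx
    have h1 : ψ x = R • x := by
      simp only [ψ]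
      rw [hg0 _ (by rw [norm_smul, Real.norm_of_nonneg hR.le]; nlinarith), add_zero]
    simp only [h1]
    rw [norm_smul, Real.norm_of_nonneg hR.le, smul_smul, mul_inv, mul_assoc, mul_comm ‖x‖⁻¹,
      ← mul_assoc, inv_mul_cancel₀ hR.ne', one_mul]

/-- A continuous map which points outwards along the unit sphere has a zero in the unit ball. -/
theorem exists_eq_zero_of_inner_pos {φ : E → E} (hφ : Continuous φ)
    (hpos : ∀ x, ‖x‖ = 1 → 0 < inner ℝ x (φ x)) : ∃ x, ‖x‖ ≤ 1 ∧ φ x = 0 := by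
  -- `s` vanishes on the unit ball and is `1` from radius 2 on; `π` is the radial retraction. The
  -- map `(1 - s) φ ∘ π + s id` is `φ` on the ball and the identity far away, and outside the ball
  -- its inner product with `π x` is positive.
  let s : E → ℝ := fun x => min 1 (max 0 (‖x‖ - 1))
  let π : E → E := fun x => (max 1 ‖x‖)⁻¹ • x
  have hs : Continuous s := by fun_prop
  have hπ : Continuous π := by
    refine Continuous.smul (Continuous.inv₀ (by fun_prop) fun x => ?_) continuous_id
    exact (lt_max_of_lt_left one_pos).ne'
  obtain ⟨x, hx⟩ := exists_eq_zero_of_eq_id_outside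
    (φ := fun x => (1 - s x) • φ (π x) + s x • x)
    (((continuous_const.sub hs).smul (hφ.comp hπ)).add (hs.smul continuous_id)) two_pos
    (fun x hx => by
      have : s x = 1 := min_eq_left (le_max_of_le_right (by linarith))
      simp [this])
  rcases le_or_gt ‖x‖ 1 with h | h
  · have h1 : s x = 0 := by
      simp only [s]; rw [max_eq_left (by linarith)]; norm_num
    have h2 : π x = x := by simp only [π]; rw [max_eq_left h]; simp
    exact ⟨x, h, by simpa [h1, h2] using hx⟩
  · exfalso
    have hx0 : 0 < ‖x‖ := one_pos.trans h
    have h1 : π x = ‖x‖⁻¹ • x := by simp only [π]; rw [max_eq_right h.le]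
    have h2 : ‖π x‖ = 1 := by
      rw [h1, norm_smul, norm_inv, norm_norm, inv_mul_cancel₀ hx0.ne']
    have h3 := hpos _ h2
    have h4 : x = ‖x‖ • π x := by rw [h1, smul_smul, mul_inv_cancel₀ hx0.ne', one_smul]
    have hs0 : 0 < s x := lt_min one_pos (lt_max_of_lt_right (by linarith))
    have hs1 : s x ≤ 1 := min_le_left _ _
    have h5 : inner ℝ (π x) ((1 - s x) • φ (π x) + s x • x) =
        (1 - s x) * inner ℝ (π x) (φ (π x)) + s x * ‖x‖ := by
      rw [inner_add_right, real_inner_smul_right, real_inner_smul_right]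
      congr 2
      conv_lhs => arg 3; rw [h4]
      rw [real_inner_smul_right, real_inner_self_eq_norm_sq, h2]
      simp
    rw [hx, inner_zero_right] at h5
    have h6 : 0 ≤ (1 - s x) * inner ℝ (π x) (φ (π x)) := mul_nonneg (by linarith) h3.le
    nlinarith [mul_pos hs0 hx0]

end Brouwer

/-! ### Convexity from uniqueness of minimizers. -/

section UniqueMinimizers

open Filter

/-- If every linear functional attains its minimum over the image under `F` of a compact
star-shaped set at exactly one point of that set, then the image is convex. -/
theorem convex_image_of_unique_minimizers {V E : Type*} [NormedAddCommGroup V] [NormedSpace ℝ V]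
    [NormedAddCommGroup E] [InnerProductSpace ℝ E] [FiniteDimensional ℝ E]
    {B : Set V} (hB : IsCompact B) (h0 : StarConvex ℝ 0 B) (hB0 : (0 : V) ∈ B) {F : V → E}
    (hF : Continuous F)
    (huniq : ∀ c : E, ‖c‖ = 1 → ∀ y₁ ∈ B, ∀ y₂ ∈ B,
      IsMinOn (fun y => inner ℝ c (F y)) B y₁ → IsMinOn (fun y => inner ℝ c (F y)) B y₂ →
        y₁ = y₂) :
    Convex ℝ (F '' B) := by
  replace huniq : ∀ c : E, c ≠ 0 → ∀ y₁ ∈ B, ∀ y₂ ∈ B,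
      IsMinOn (fun y => inner ℝ c (F y)) B y₁ → IsMinOn (fun y => inner ℝ c (F y)) B y₂ →
        y₁ = y₂ := by
    intro c hc y₁ hy₁ y₂ hy₂ h₁ h₂
    have hscale : ∀ y, IsMinOn (fun y => inner ℝ c (F y)) B y →
        IsMinOn (fun y => inner ℝ (‖c‖⁻¹ • c) (F y)) B y := fun y hy z hz => by
      change inner ℝ (‖c‖⁻¹ • c) (F y) ≤ inner ℝ (‖c‖⁻¹ • c) (F z)
      rw [real_inner_smul_left, real_inner_smul_left]
      exact mul_le_mul_of_nonneg_left (hy hz) (inv_nonneg.2 (norm_nonneg c))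
    refine huniq (‖c‖⁻¹ • c) ?_ y₁ hy₁ y₂ hy₂ (hscale _ h₁) (hscale _ h₂)
    rw [norm_smul, norm_inv, norm_norm, inv_mul_cancel₀ (norm_ne_zero_iff.2 hc)]
  have hex : ∀ c : E, ∃ y ∈ B, IsMinOn (fun y => inner ℝ c (F y)) B y := fun c =>
    hB.exists_isMinOn ⟨0, hB0⟩ (continuous_const.inner hF).continuousOn
  choose g hgB hgmin using hex
  -- By compactness the minimizers converge along any ultrafilter tending to `c`; the limit
  -- minimizes the functional of `c`, so by uniqueness it is `g c`.
  have hgc : ∀ c : E, c ≠ 0 → ContinuousAt g c := by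
    intro c hc
    refine (tendsto_iff_ultrafilter _ _ _).2 fun U hU => ?_
    obtain ⟨y, hy, hUy⟩ := hB.ultrafilter_le_nhds (U.map g)
      (le_principal_iff.2 (Ultrafilter.mem_map.2 (univ_mem' hgB)))
    have hgU : Tendsto g U (𝓝 y) := hUy
    have hidU : Tendsto (fun c : E => c) U (𝓝 c) := hU
    have hmin : IsMinOn (fun y => inner ℝ c (F y)) B y := fun z hz => by
      change inner ℝ c (F y) ≤ inner ℝ c (F z)
      exact le_of_tendsto_of_tendsto (hidU.inner ((hF.tendsto y).comp hgU))
        (hidU.inner tendsto_const_nhds) (Eventually.of_forall fun c' => hgmin c' hz)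
    rwa [huniq c hc _ (hgB c) _ hy (hgmin c) hmin]
  -- Boundedness of `B` gives continuity at the origin, where `g` may jump; star-shapedness keeps
  -- `G` in `B` on the unit ball.
  let G : E → V := fun x => ‖x‖ • g x
  have hG : Continuous G := by
    refine continuous_iff_continuousAt.2 fun x => ?_
    rcases eq_or_ne x 0 with rfl | hx
    · obtain ⟨C, hC⟩ := hB.isBounded.exists_norm_le
      have h1 : Tendsto (fun x : E => ‖x‖ * C) (𝓝 0) (𝓝 0) := by
        have : Continuous fun x : E => ‖x‖ * C := by fun_prop
        simpa using this.tendsto 0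
      have h2 : G 0 = 0 := by simp [G]
      rw [ContinuousAt, h2]
      refine squeeze_zero_norm (fun x => ?_) h1
      rw [norm_smul, norm_norm]
      exact mul_le_mul_of_nonneg_left (hC _ (hgB x)) (norm_nonneg x)
    · exact continuousAt_id.norm.smul (hgc x hx)
  rintro _ ⟨y₁, hy₁, rfl⟩ _ ⟨y₂, hy₂, rfl⟩ s t hs ht hst
  rcases hs.eq_or_lt with rfl | hs
  · obtain rfl : t = 1 := by linarith
    exact ⟨y₂, hy₂, by simp⟩
  rcases ht.eq_or_lt with rfl | ht
  · obtain rfl : s = 1 := by linarith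
    exact ⟨y₁, hy₁, by simp⟩
  set p := s • F y₁ + t • F y₂ with hp
  have hle : ∀ c : E, inner ℝ c (p - F (g c)) = s * (inner ℝ c (F y₁) - inner ℝ c (F (g c))) +
      t * (inner ℝ c (F y₂) - inner ℝ c (F (g c))) := fun c => by
    rw [hp, inner_sub_right, inner_add_right, real_inner_smul_right, real_inner_smul_right]
    linear_combination (inner ℝ c (F (g c))) * hst
  have hnn : ∀ (c : E), ∀ y ∈ B, 0 ≤ inner ℝ c (F y) - inner ℝ c (F (g c)) :=
    fun c y hy => sub_nonneg.2 (hgmin c hy)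
  -- If `p` lies strictly above every supporting hyperplane, `p - F ∘ G` points outwards on the
  -- sphere and has a zero. Otherwise `p` lies on a supporting hyperplane, so do both endpoints, and
  -- uniqueness identifies them.
  by_cases hstrict : ∀ c : E, ‖c‖ = 1 → 0 < inner ℝ c (p - F (g c))
  · obtain ⟨x, hx, hx0⟩ := exists_eq_zero_of_inner_pos (φ := fun x => p - F (G x))
      (continuous_const.sub (hF.comp hG)) (fun c hc => by simpa [G, hc] using hstrict c hc)
    exact ⟨G x, h0.smul_mem (hgB x) (norm_nonneg x) hx, (sub_eq_zero.1 hx0).symm⟩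
  · push Not at hstrict
    obtain ⟨c, hc, hcle⟩ := hstrict
    have hc0 : c ≠ 0 := by
      rintro rfl
      simp at hc
    have h1 := hnn c y₁ hy₁
    have h2 := hnn c y₂ hy₂
    rw [hle] at hcle
    have hmin : ∀ y, y ∈ B → inner ℝ c (F y) - inner ℝ c (F (g c)) = 0 → y = g c := by
      intro y hy hyeq
      refine huniq c hc0 y hy _ (hgB c) (fun z hz => ?_) (hgmin c)
      have := hnn c z hz
      change inner ℝ c (F y) ≤ inner ℝ c (F z)
      linarith
    have e1 : y₁ = g c := hmin y₁ hy₁ (by nlinarith)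
    have e2 : y₂ = g c := hmin y₂ hy₂ (by nlinarith)
    refine ⟨g c, hgB c, ?_⟩
    rw [hp, e1, e2, ← add_smul, hst, one_smul]

end UniqueMinimizers

/-! ### Hermitian forms and the smallest generalized eigenvalue. -/

section Forms

variable {𝕜 : Type*} [RCLike 𝕜] {n m : ℕ}

theorem re_star_dotProduct_comm (x y : Fin n → 𝕜) :
    RCLike.re (star x ⬝ᵥ y) = RCLike.re (star y ⬝ᵥ x) := by
  have h : star (star x ⬝ᵥ y) = star y ⬝ᵥ x := by
    rw [Matrix.star_dotProduct, star_star]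
  rw [← h]
  exact (RCLike.conj_re _).symm

theorem re_star_dotProduct_mulVec_comm {M : Matrix (Fin n) (Fin n) 𝕜} (hM : M.IsHermitian)
    (x y : Fin n → 𝕜) :
    RCLike.re (star x ⬝ᵥ (M *ᵥ y)) = RCLike.re (star y ⬝ᵥ (M *ᵥ x)) := by
  rw [re_star_dotProduct_comm, Matrix.star_mulVec, hM.eq, Matrix.dotProduct_mulVec]

theorem continuous_plusNormSq (M : Matrix (Fin n) (Fin n) 𝕜) : Continuous (plusNormSq M) := by
  unfold plusNormSq
  fun_prop

theorem plusNormSq_smul (M : Matrix (Fin n) (Fin n) 𝕜) (t : ℝ) (x : Fin n → 𝕜) :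
    plusNormSq M (t • x) = t ^ 2 * plusNormSq M x := by
  simp only [plusNormSq, star_smul, Matrix.mulVec_smul, smul_dotProduct, dotProduct_smul,
    RCLike.smul_re, star_trivial]
  ring

theorem plusNormSq_neg (M : Matrix (Fin n) (Fin n) 𝕜) (x : Fin n → 𝕜) :
    plusNormSq (-M) x = -plusNormSq M x := by
  simp [plusNormSq, Matrix.neg_mulVec]

theorem plusNormSq_sub_smul (M P : Matrix (Fin n) (Fin n) 𝕜) (l : ℝ) (x : Fin n → 𝕜) :
    plusNormSq (M - l • P) x = plusNormSq M x - l * plusNormSq P x := by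
  simp only [plusNormSq, Matrix.sub_mulVec, Matrix.smul_mulVec, dotProduct_sub, dotProduct_smul,
    map_sub, RCLike.smul_re]

theorem plusNormSq_add_smul {M : Matrix (Fin n) (Fin n) 𝕜} (hM : M.IsHermitian)
    (x y : Fin n → 𝕜) (t : ℝ) :
    plusNormSq M (x + t • y) = plusNormSq M x + 2 * t * RCLike.re (star x ⬝ᵥ (M *ᵥ y)) +
      t ^ 2 * plusNormSq M y := by
  have h := re_star_dotProduct_mulVec_comm hM y x
  simp only [plusNormSq, star_add, star_smul, Matrix.mulVec_add, Matrix.mulVec_smul,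
    add_dotProduct, dotProduct_add, smul_dotProduct, dotProduct_smul, map_add,
    RCLike.smul_re, star_trivial, h]
  ring

theorem plusNormSq_pos {P : Matrix (Fin n) (Fin n) 𝕜} (hP : P.PosDef) {x : Fin n → 𝕜}
    (hx : x ≠ 0) : 0 < plusNormSq P x :=
  hP.re_dotProduct_pos hx

theorem plusNormSq_zero (M : Matrix (Fin n) (Fin n) 𝕜) : plusNormSq M 0 = 0 := by
  simp [plusNormSq]

theorem posSemidef_of_plusNormSq_nonneg {M : Matrix (Fin n) (Fin n) 𝕜} (hM : M.IsHermitian)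
    (h : ∀ x, 0 ≤ plusNormSq M x) : M.PosSemidef := by
  refine Matrix.PosSemidef.of_dotProduct_mulVec_nonneg hM fun x => ?_
  rw [RCLike.nonneg_iff]
  exact ⟨h x, hM.im_star_dotProduct_mulVec_self x⟩

theorem isHermitian_real_smul {M : Matrix (Fin n) (Fin n) 𝕜} (hM : M.IsHermitian) (t : ℝ) :
    (t • M).IsHermitian := by
  rw [Matrix.IsHermitian, Matrix.conjTranspose_smul, hM.eq, star_trivial]

/-- Minimizing the Rayleigh quotient yields a generalized eigenvalue that bounds it from below. -/
theorem exists_genEigenvalue_le_rayleigh {M P : Matrix (Fin n) (Fin n) 𝕜} (hn : n ≠ 0)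
    (hM : M.IsHermitian) (hP : P.PosDef) :
    ∃ μ ∈ genEigenvalues P M, ∀ y, μ * plusNormSq P y ≤ plusNormSq M y := by
  have : Nonempty (Fin n) := ⟨⟨0, Nat.pos_of_ne_zero hn⟩⟩
  have hne : ∀ x ∈ Metric.sphere (0 : Fin n → 𝕜) 1, x ≠ 0 := fun x hx =>
    Metric.ne_of_mem_sphere hx one_ne_zero
  obtain ⟨x, hx, hmin⟩ := (isCompact_sphere (0 : Fin n → 𝕜) 1).exists_isMinOn
    ⟨fun _ => 1, mem_sphere_zero_iff_norm.2 (by rw [pi_norm_const, norm_one])⟩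
    (f := fun x => plusNormSq M x / plusNormSq P x)
    ((continuous_plusNormSq M).continuousOn.div (continuous_plusNormSq P).continuousOn
      fun x hx => (plusNormSq_pos hP (hne x hx)).ne')
  set μ := plusNormSq M x / plusNormSq P x with hμ
  have hle : ∀ y, μ * plusNormSq P y ≤ plusNormSq M y := by
    intro y
    rcases eq_or_ne y 0 with rfl | hy
    · simp [plusNormSq_zero]
    have hy0 : 0 < ‖y‖ := norm_pos_iff.2 hy
    have h1 : ‖y‖⁻¹ • y ∈ Metric.sphere (0 : Fin n → 𝕜) 1 := by
      rw [mem_sphere_zero_iff_norm, norm_smul, norm_inv, norm_norm, inv_mul_cancel₀ hy0.ne']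
    have h2 : μ ≤ plusNormSq M (‖y‖⁻¹ • y) / plusNormSq P (‖y‖⁻¹ • y) := hmin h1
    rw [le_div_iff₀ (plusNormSq_pos hP (hne _ h1)), plusNormSq_smul, plusNormSq_smul] at h2
    have h3 : 0 < ‖y‖⁻¹ ^ 2 := by positivity
    refine le_of_mul_le_mul_left ?_ h3
    linarith
  refine ⟨μ, ⟨x, hne x hx, ?_⟩, hle⟩
  -- A positive semidefinite form vanishes only on the kernel of its matrix, so the minimizing
  -- vector is a generalized eigenvector.
  have hN : (M - μ • P).PosSemidef :=
    posSemidef_of_plusNormSq_nonneg (hM.sub (isHermitian_real_smul hP.1 μ)) fun y => by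
      rw [plusNormSq_sub_smul]; linarith [hle y]
  rw [← hN.dotProduct_mulVec_zero_iff x]
  refine RCLike.ext ?_ ?_
  · have : plusNormSq (M - μ • P) x = 0 := by
      rw [plusNormSq_sub_smul, hμ, div_mul_cancel₀ _ (plusNormSq_pos hP (hne x hx)).ne', sub_self]
    simpa [plusNormSq] using this
  · simpa using hN.1.im_star_dotProduct_mulVec_self x

theorem lamMin_mul_plusNormSq_le {M P : Matrix (Fin n) (Fin n) 𝕜}
    (hM : M.IsHermitian) (hP : P.PosDef) (y : Fin n → 𝕜) :
    lamMin P M * plusNormSq P y ≤ plusNormSq M y := by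
  rcases eq_or_ne n 0 with rfl | hn
  · rw [Subsingleton.elim y 0, plusNormSq_zero, plusNormSq_zero, mul_zero]
  obtain ⟨μ, hμ, hle⟩ := exists_genEigenvalue_le_rayleigh hn hM hP
  have hleast : IsLeast (genEigenvalues P M) μ := by
    refine ⟨hμ, ?_⟩
    rintro l ⟨x, hx, hlx⟩
    have h1 : plusNormSq (M - l • P) x = 0 := by simp [plusNormSq, hlx]
    rw [plusNormSq_sub_smul] at h1
    exact le_of_mul_le_mul_right (by linarith [hle x]) (plusNormSq_pos hP hx)
  rw [lamMin, hleast.csInf_eq]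
  exact hle y

theorem posSemidef_sub_lamMin_smul {M P : Matrix (Fin n) (Fin n) 𝕜}
    (hM : M.IsHermitian) (hP : P.PosDef) : (M - lamMin P M • P).PosSemidef :=
  posSemidef_of_plusNormSq_nonneg (hM.sub (isHermitian_real_smul hP.1 _)) fun y => by
    rw [plusNormSq_sub_smul]; linarith [lamMin_mul_plusNormSq_le hM hP y]

theorem isCompact_plusNormSq_le {P : Matrix (Fin n) (Fin n) 𝕜} (hP : P.PosDef) (ρ : ℝ) :
    IsCompact {y : Fin n → 𝕜 | plusNormSq P y ≤ ρ} := by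
  refine Metric.isCompact_of_isClosed_isBounded
    (isClosed_le (continuous_plusNormSq P) continuous_const) ?_
  rcases eq_or_ne n 0 with rfl | hn
  · exact (Set.toFinite _).isBounded
  have : Nonempty (Fin n) := ⟨⟨0, Nat.pos_of_ne_zero hn⟩⟩
  obtain ⟨x, hx, hmin⟩ := (isCompact_sphere (0 : Fin n → 𝕜) 1).exists_isMinOn
    ⟨fun _ => 1, mem_sphere_zero_iff_norm.2 (by rw [pi_norm_const, norm_one])⟩ (continuous_plusNormSq P).continuousOn
  have hμ : 0 < plusNormSq P x := plusNormSq_pos hP (Metric.ne_of_mem_sphere hx one_ne_zero)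
  refine isBounded_iff_forall_norm_le.2 ⟨Real.sqrt (ρ / plusNormSq P x), fun y hy => ?_⟩
  refine Real.le_sqrt_of_sq_le ?_
  rw [le_div_iff₀ hμ]
  refine le_trans ?_ (show plusNormSq P y ≤ ρ from hy)
  rcases eq_or_ne y 0 with rfl | hy0
  · simp [plusNormSq_zero]
  have hy0 : 0 < ‖y‖ := norm_pos_iff.2 hy0
  have h1 : ‖y‖⁻¹ • y ∈ Metric.sphere (0 : Fin n → 𝕜) 1 := by
    rw [mem_sphere_zero_iff_norm, norm_smul, norm_inv, norm_norm, inv_mul_cancel₀ hy0.ne']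
  have h2 : plusNormSq P x ≤ plusNormSq P (‖y‖⁻¹ • y) := hmin h1
  rw [plusNormSq_smul] at h2
  calc ‖y‖ ^ 2 * plusNormSq P x ≤ ‖y‖ ^ 2 * (‖y‖⁻¹ ^ 2 * plusNormSq P y) := by gcongr
    _ = plusNormSq P y := by field_simp

end Forms

/-! ### Uniqueness of the minimizer of a quadratic function on a ball. -/

section Minimizers

variable {𝕜 : Type*} [RCLike 𝕜] {n m : ℕ}

/-- From a point inside the ball one reaches the boundary along a kernel vector of `N` that is
not orthogonal to `b` so that the function `x* N x - 2 Re x* b` decreases. -/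
theorem exists_boundary_lt_of_kernel {N P : Matrix (Fin n) (Fin n) 𝕜} (hN : N.IsHermitian)
    (hP : P.PosDef) {b z : Fin n → 𝕜} (hz : N *ᵥ z = 0) (hzb : RCLike.re (star z ⬝ᵥ b) ≠ 0)
    {ρ : ℝ} {w : Fin n → 𝕜} (hw : plusNormSq P w < ρ) :
    ∃ w', plusNormSq P w' = ρ ∧ plusNormSq N w' - 2 * RCLike.re (star w' ⬝ᵥ b) <
      plusNormSq N w - 2 * RCLike.re (star w ⬝ᵥ b) := by
  wlog hpos : 0 < RCLike.re (star z ⬝ᵥ b) generalizing z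
  · have hlt : RCLike.re (star z ⬝ᵥ b) < 0 := lt_of_le_of_ne (not_lt.1 hpos) hzb
    exact this (z := -z) (by rw [Matrix.mulVec_neg, hz, neg_zero]) (by simpa using hzb)
      (by simpa using hlt)
  have hz0 : z ≠ 0 := by
    rintro rfl
    simp at hzb
  set γ := plusNormSq P z with hγ
  have hγ0 : 0 < γ := plusNormSq_pos hP hz0
  set α := RCLike.re (star w ⬝ᵥ (P *ᵥ z)) with hα
  set κ := ρ - plusNormSq P w with hκ
  have hκ0 : 0 < κ := sub_pos.2 hw
  set D := Real.sqrt (α ^ 2 + γ * κ) with hD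
  have hDsq : D ^ 2 = α ^ 2 + γ * κ := Real.sq_sqrt (by positivity)
  have hDα : α < D := by
    refine lt_of_le_of_lt (le_abs_self α) ?_
    rw [← Real.sqrt_sq_eq_abs]
    exact Real.sqrt_lt_sqrt (sq_nonneg _) (by nlinarith [mul_pos hγ0 hκ0])
  -- The positive root of `γ t² + 2 α t = κ`, the condition for `w + t z` to reach the sphere.
  set t := (D - α) / γ with ht
  have ht0 : 0 < t := div_pos (sub_pos.2 hDα) hγ0
  have htγ : t * γ = D - α := div_mul_cancel₀ _ hγ0.ne'
  refine ⟨w + t • z, ?_, ?_⟩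
  · rw [plusNormSq_add_smul hP.1, ← hα, ← hγ]
    have h1 : γ * (2 * t * α + t ^ 2 * γ) = γ * κ := by
      calc γ * (2 * t * α + t ^ 2 * γ) = 2 * (t * γ) * α + (t * γ) ^ 2 := by ring
        _ = γ * κ := by rw [htγ]; linear_combination hDsq
    have h2 := mul_left_cancel₀ hγ0.ne' h1
    linarith
  · rw [plusNormSq_add_smul hN, hz, star_add, star_smul, add_dotProduct, smul_dotProduct, map_add,
      RCLike.smul_re, star_trivial t]
    have h1 : plusNormSq N z = 0 := by simp [plusNormSq, hz]
    rw [h1]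
    simp only [dotProduct_zero, map_zero, mul_zero, add_zero]
    nlinarith [mul_pos ht0 hpos]

theorem plusNormSq_midpoint {M : Matrix (Fin n) (Fin n) 𝕜} (hM : M.IsHermitian)
    (x y : Fin n → 𝕜) :
    plusNormSq M (x + (1 / 2 : ℝ) • (y - x)) =
      (plusNormSq M x + plusNormSq M y) / 2 - plusNormSq M (y - x) / 4 := by
  have h : plusNormSq M y = plusNormSq M (x + (1 : ℝ) • (y - x)) := by simp
  rw [h, plusNormSq_add_smul hM, plusNormSq_add_smul hM]
  ring

theorem re_star_midpoint_dotProduct (x y b : Fin n → 𝕜) :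
    RCLike.re (star (x + (1 / 2 : ℝ) • (y - x)) ⬝ᵥ b) =
      (RCLike.re (star x ⬝ᵥ b) + RCLike.re (star y ⬝ᵥ b)) / 2 := by
  simp only [star_add, star_smul, star_sub, add_dotProduct, smul_dotProduct, sub_dotProduct,
    map_add, map_sub, RCLike.smul_re, star_trivial]
  ring

/-- Uniqueness of the minimizer of `x* M x - 2 Re x* b` over a ball of the norm `|·|₊`. -/
theorem eq_of_isMinOn {M P : Matrix (Fin n) (Fin n) 𝕜} (hM : M.IsHermitian) (hP : P.PosDef)
    {b : Fin n → 𝕜} {ρ : ℝ}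
    (hb : lamMin P M ≤ 0 → ∃ z, (M - lamMin P M • P) *ᵥ z = 0 ∧ RCLike.re (star z ⬝ᵥ b) ≠ 0)
    {y₁ y₂ : Fin n → 𝕜} (hy₁ : plusNormSq P y₁ ≤ ρ) (hy₂ : plusNormSq P y₂ ≤ ρ)
    (h₁ : ∀ y, plusNormSq P y ≤ ρ → plusNormSq M y₁ - 2 * RCLike.re (star y₁ ⬝ᵥ b) ≤
      plusNormSq M y - 2 * RCLike.re (star y ⬝ᵥ b))
    (h₂ : ∀ y, plusNormSq P y ≤ ρ → plusNormSq M y₂ - 2 * RCLike.re (star y₂ ⬝ᵥ b) ≤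
      plusNormSq M y - 2 * RCLike.re (star y ⬝ᵥ b)) : y₁ = y₂ := by
  by_contra hne
  have hd : 0 < plusNormSq P (y₂ - y₁) := plusNormSq_pos hP (sub_ne_zero.2 (Ne.symm hne))
  set w := y₁ + (1 / 2 : ℝ) • (y₂ - y₁) with hwdef
  have hwP := plusNormSq_midpoint hP.1 y₁ y₂
  have hwM := plusNormSq_midpoint hM y₁ y₂
  have hwb := re_star_midpoint_dotProduct y₁ y₂ b
  rw [← hwdef] at hwP hwM hwb
  have hwρ : plusNormSq P w < ρ := by linarith
  have e12 := h₁ y₂ hy₂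
  have e21 := h₂ y₁ hy₁
  -- The midpoint `w` of two distinct minimizers is strictly inside the ball. For a positive
  -- eigenvalue, strict convexity makes `w` better than both.
  rcases lt_or_ge 0 (lamMin P M) with hlam | hlam
  · have hdM := lamMin_mul_plusNormSq_le hM hP (y₂ - y₁)
    have := mul_pos hlam hd
    have := h₁ w hwρ.le
    linarith
  · obtain ⟨z, hz, hzb⟩ := hb hlam
    set l := lamMin P M
    have hN : (M - l • P).PosSemidef := posSemidef_sub_lamMin_smul hM hP
    have hsplit := fun y => plusNormSq_sub_smul M P l y
    -- Since `M = N + l P` with `l ≤ 0`, reaching the sphere while lowering the `N`-function also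
    -- lowers the `M`-function; hence minimizers lie on the sphere.
    have hbd : ∀ y, plusNormSq P y ≤ ρ → (∀ y', plusNormSq P y' ≤ ρ →
        plusNormSq M y - 2 * RCLike.re (star y ⬝ᵥ b) ≤
          plusNormSq M y' - 2 * RCLike.re (star y' ⬝ᵥ b)) → plusNormSq P y = ρ := by
      intro y hy hmin
      by_contra hlt
      obtain ⟨w', hw', hlt'⟩ := exists_boundary_lt_of_kernel hN.1 hP hz hzb
        (lt_of_le_of_ne hy hlt)
      have h3 := hmin w' hw'.le
      rw [hsplit, hsplit, hw'] at hlt'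
      nlinarith
    have hr₁ := hbd y₁ hy₁ h₁
    have hr₂ := hbd y₂ hy₂ h₂
    -- On the sphere the `M`- and `N`-functions differ by the constant `l ρ`. The `N`-function is
    -- convex, so at `w` it is at most its common value at the minimizers, and `w'` beats them.
    obtain ⟨w', hw', hlt'⟩ := exists_boundary_lt_of_kernel hN.1 hP hz hzb hwρ
    have h3 := h₁ w' hw'.le
    have hdN : 0 ≤ plusNormSq (M - l • P) (y₂ - y₁) := hN.re_dotProduct_nonneg _
    have hwN := plusNormSq_midpoint hN.1 y₁ y₂
    rw [← hwdef] at hwN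
    rw [hwN, hsplit, hsplit, hsplit, hw', hr₁, hr₂] at hlt'
    linarith

end Minimizers

/-! ### What an infinite `ε_max` says about the kernel. -/

section Resolvent

variable {𝕜 : Type*} [RCLike 𝕜] {n m : ℕ}

/-- A vector orthogonal to the kernel of a Hermitian matrix is in its range. -/
theorem exists_mulVec_eq_of_orthogonal_kernel {N : Matrix (Fin n) (Fin n) 𝕜} (hN : N.IsHermitian)
    {b : Fin n → 𝕜} (hb : ∀ z, N *ᵥ z = 0 → RCLike.re (star z ⬝ᵥ b) = 0) :
    ∃ w, N *ᵥ w = b := by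
  let T := Matrix.toEuclideanLin N
  have hT : T.IsSymmetric := Matrix.isSymmetric_toEuclideanLin_iff.2 hN
  have hmem : WithLp.toLp 2 b ∈ LinearMap.range T := by
    rw [← Submodule.orthogonal_orthogonal (LinearMap.range T), hT.orthogonal_range,
      Submodule.mem_orthogonal]
    intro z hz
    have hNz : N *ᵥ z.ofLp = 0 := congrArg WithLp.ofLp (LinearMap.mem_ker.1 hz)
    have hinner : inner 𝕜 z (WithLp.toLp 2 b) = star z.ofLp ⬝ᵥ b := by
      rw [EuclideanSpace.inner_eq_star_dotProduct, dotProduct_comm]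
    rw [hinner]
    -- Scaling `z` by its own pairing with `b` turns the hypothesis on real parts into the vanishing
    -- of `|z* b|²`, which covers the complex case.
    have h1 := hb ((star z.ofLp ⬝ᵥ b) • z.ofLp) (by rw [Matrix.mulVec_smul, hNz, smul_zero])
    rw [star_smul, smul_dotProduct, smul_eq_mul, RCLike.star_def, RCLike.conj_mul] at h1
    have h2 : ‖star z.ofLp ⬝ᵥ b‖ ^ 2 = 0 := by exact_mod_cast h1
    simpa using h2
  obtain ⟨w, hw⟩ := hmem
  exact ⟨w.ofLp, congrArg WithLp.ofLp hw⟩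

/-- With `u = (N + ε)⁻¹ N w` one has `N (w - u) = ε u`, so `N ⪰ 0` gives `Re u* (w - u) ≥ 0` and
hence `|u| ≤ |w|`. The bound is uniform in `ε`. -/
theorem plusNormSq_one_le_of_resolvent {N : Matrix (Fin n) (Fin n) 𝕜} (hN : N.PosSemidef)
    {ε : ℝ} (hε : 0 < ε) (w : Fin n → 𝕜) :
    plusNormSq 1 ((N + ε • (1 : Matrix (Fin n) (Fin n) 𝕜))⁻¹ *ᵥ (N *ᵥ w)) ≤ plusNormSq 1 w := by
  have hpd : (N + ε • (1 : Matrix (Fin n) (Fin n) 𝕜)).PosDef :=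
    Matrix.PosDef.posSemidef_add hN (Matrix.PosDef.one.smul hε)
  have hunit : IsUnit (N + ε • (1 : Matrix (Fin n) (Fin n) 𝕜)).det :=
    (Matrix.isUnit_iff_isUnit_det _).1 hpd.isUnit
  set u := (N + ε • (1 : Matrix (Fin n) (Fin n) 𝕜))⁻¹ *ᵥ (N *ᵥ w) with hu
  have hNu : (N + ε • (1 : Matrix (Fin n) (Fin n) 𝕜)) *ᵥ u = N *ᵥ w := by
    rw [hu, Matrix.mulVec_mulVec, Matrix.mul_nonsing_inv _ hunit, Matrix.one_mulVec]
  have hd : N *ᵥ (w - u) = ε • u := by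
    rw [Matrix.mulVec_sub, ← hNu, Matrix.add_mulVec, Matrix.smul_mulVec, Matrix.one_mulVec]
    abel
  have h1 : 0 ≤ RCLike.re (star (w - u) ⬝ᵥ (N *ᵥ (w - u))) := hN.re_dotProduct_nonneg _
  rw [hd, dotProduct_smul, RCLike.smul_re, re_star_dotProduct_comm] at h1
  have h2 : 0 ≤ RCLike.re (star u ⬝ᵥ (w - u)) := nonneg_of_mul_nonneg_right h1 hε
  have h3 := plusNormSq_add_smul (M := (1 : Matrix (Fin n) (Fin n) 𝕜)) Matrix.isHermitian_one
    u (w - u) 1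
  have h4 : 0 ≤ plusNormSq (1 : Matrix (Fin n) (Fin n) 𝕜) (w - u) :=
    Matrix.PosSemidef.one.re_dotProduct_nonneg _
  rw [one_smul, add_sub_cancel, Matrix.one_mulVec] at h3
  linarith

/-- Transfers the Euclidean resolvent bound to `|·|₊`; `-lamMin 1 (-P)` plays the role of the
largest eigenvalue of `P`. -/
theorem exists_plusNormSq_le_mul {P : Matrix (Fin n) (Fin n) 𝕜} (hP : P.IsHermitian) :
    ∃ C : ℝ, 0 ≤ C ∧ ∀ y, plusNormSq P y ≤ C * plusNormSq 1 y := by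
  refine ⟨max 0 (-lamMin 1 (-P)), le_max_left _ _, fun y => ?_⟩
  have h1 := lamMin_mul_plusNormSq_le hP.neg Matrix.PosDef.one y
  rw [plusNormSq_neg] at h1
  have h2 : 0 ≤ plusNormSq (1 : Matrix (Fin n) (Fin n) 𝕜) y :=
    Matrix.PosSemidef.one.re_dotProduct_nonneg _
  nlinarith [le_max_right 0 (-lamMin 1 (-P))]

theorem combMat_isHermitian {A : Fin m → Matrix (Fin n) (Fin n) 𝕜} (hA : ∀ i, (A i).IsHermitian)
    (c : Fin m → ℝ) : (combMat c A).IsHermitian := by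
  rw [Matrix.IsHermitian, combMat, Matrix.conjTranspose_sum]
  exact Finset.sum_congr rfl fun i _ => isHermitian_real_smul (hA i) (c i)

/-- If `ε_max = ∞`, then for `c ∈ 𝒞` the vector `c · (v - A x₀)` is not orthogonal to the
eigenspace of the smallest generalized eigenvalue. -/
theorem exists_kernel_of_hasEpsMaxSq_top {A : Fin m → Matrix (Fin n) (Fin n) 𝕜}
    (hA : ∀ i, (A i).IsHermitian) {v : Fin m → Fin n → 𝕜} {x₀ : Fin n → 𝕜}
    {P : Matrix (Fin n) (Fin n) 𝕜} (hP : P.PosDef) (hmax : HasEpsMaxSq A v x₀ P ⊤)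
    {c : Fin m → ℝ} (hc : c ∈ admissible A P) :
    ∃ z, (combMat c A - lamMin P (combMat c A) • P) *ᵥ z = 0 ∧
      RCLike.re (star z ⬝ᵥ combVec c A v x₀) ≠ 0 := by
  by_contra! hcon
  have hN := posSemidef_sub_lamMin_smul (combMat_isHermitian hA c) hP
  obtain ⟨w, hw⟩ := exists_mulVec_eq_of_orthogonal_kernel hN.1 hcon
  obtain ⟨C, hC0, hC⟩ := exists_plusNormSq_le_mul hP.1
  have hbound : ∀ ε > 0, minResolventNormSq A v x₀ P ε ≤
      ENNReal.ofReal (C * plusNormSq 1 w) := by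
    intro ε hε
    refine (iInf₂_le c hc).trans (ENNReal.ofReal_le_ofReal ?_)
    rw [resolventNormSq, ← hw]
    exact (hC _).trans (mul_le_mul_of_nonneg_left (plusNormSq_one_le_of_resolvent hN hε w) hC0)
  have hev : ∀ᶠ ε in 𝓝[>] (0 : ℝ),
      ENNReal.ofReal (C * plusNormSq 1 w) < minResolventNormSq A v x₀ P ε :=
    Filter.Tendsto.eventually_const_lt ENNReal.ofReal_lt_top hmax
  obtain ⟨ε, hlt, hε⟩ := (hev.and self_mem_nhdsWithin).exists
  exact absurd (hbound ε hε) (not_le.2 hlt)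

end Resolvent

/-! ### Convexity of the images of balls and of the full image. -/

section Image

variable {𝕜 : Type*} [RCLike 𝕜] {n m : ℕ}

theorem continuous_quadMap (A : Fin m → Matrix (Fin n) (Fin n) 𝕜) (v : Fin m → Fin n → 𝕜)
    (f₀ : Fin m → ℝ) : Continuous (quadMap A v f₀) := by
  unfold quadMap
  fun_prop

theorem quadMap_add {A : Fin m → Matrix (Fin n) (Fin n) 𝕜} (hA : ∀ i, (A i).IsHermitian)
    (v : Fin m → Fin n → 𝕜) (f₀ : Fin m → ℝ) (x₀ y : Fin n → 𝕜) (i : Fin m) :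
    quadMap A v f₀ (x₀ + y) i = plusNormSq (A i) y -
      2 * RCLike.re (star y ⬝ᵥ (v i - A i *ᵥ x₀)) + quadMap A v f₀ x₀ i := by
  have h1 := re_star_dotProduct_mulVec_comm (hA i) x₀ y
  have h2 := re_star_dotProduct_comm (v i) y
  simp only [quadMap, plusNormSq, star_add, Matrix.mulVec_add, add_dotProduct, dotProduct_add,
    dotProduct_sub, map_add, map_sub, h1, h2]
  ring

theorem dotProduct_quadMap_add {A : Fin m → Matrix (Fin n) (Fin n) 𝕜}
    (hA : ∀ i, (A i).IsHermitian) (v : Fin m → Fin n → 𝕜) (f₀ : Fin m → ℝ) (x₀ y : Fin n → 𝕜)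
    (c : Fin m → ℝ) :
    c ⬝ᵥ quadMap A v f₀ (x₀ + y) = plusNormSq (combMat c A) y -
      2 * RCLike.re (star y ⬝ᵥ combVec c A v x₀) + c ⬝ᵥ quadMap A v f₀ x₀ := by
  have h1 : plusNormSq (combMat c A) y = ∑ i, c i * plusNormSq (A i) y := by
    simp only [plusNormSq, combMat, Matrix.sum_mulVec, Matrix.smul_mulVec, dotProduct_sum,
      dotProduct_smul, map_sum, RCLike.smul_re]
  have h2 : RCLike.re (star y ⬝ᵥ combVec c A v x₀) =
      ∑ i, c i * RCLike.re (star y ⬝ᵥ (v i - A i *ᵥ x₀)) := by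
    simp only [combVec, dotProduct_sum, dotProduct_smul, map_sum, RCLike.smul_re]
  rw [h1, h2, dotProduct, dotProduct, Finset.mul_sum, ← Finset.sum_sub_distrib,
    ← Finset.sum_add_distrib]
  refine Finset.sum_congr rfl fun i _ => ?_
  rw [quadMap_add hA]
  ring

/-- If `ε_max = ∞`, the image of each ball `|x - x₀|₊² ≤ ρ` is convex. -/
theorem convex_image_ball {A : Fin m → Matrix (Fin n) (Fin n) 𝕜}
    (hA : ∀ i, (A i).IsHermitian) {v : Fin m → Fin n → 𝕜} (f₀ : Fin m → ℝ) {x₀ : Fin n → 𝕜}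
    {P : Matrix (Fin n) (Fin n) 𝕜} (hP : P.PosDef) (hmax : HasEpsMaxSq A v x₀ P ⊤)
    {ρ : ℝ} (hρ : 0 ≤ ρ) :
    Convex ℝ ((fun y => WithLp.toLp 2 (quadMap A v f₀ (x₀ + y))) ''
      {y : Fin n → 𝕜 | plusNormSq P y ≤ ρ}) := by
  have hinner : ∀ (c : EuclideanSpace ℝ (Fin m)) (y : Fin n → 𝕜),
      inner ℝ c (WithLp.toLp 2 (quadMap A v f₀ (x₀ + y))) =
        plusNormSq (combMat c.ofLp A) y - 2 * RCLike.re (star y ⬝ᵥ combVec c.ofLp A v x₀) +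
          c.ofLp ⬝ᵥ quadMap A v f₀ x₀ := fun c y => by
    rw [← dotProduct_quadMap_add hA, EuclideanSpace.inner_eq_star_dotProduct, star_trivial,
      dotProduct_comm]
  refine convex_image_of_unique_minimizers (isCompact_plusNormSq_le hP ρ) ?_ ?_ ?_ ?_
  · refine starConvex_zero_iff.2 fun y hy t ht0 ht1 => ?_
    have hy' : plusNormSq P y ≤ ρ := hy
    change plusNormSq P (t • y) ≤ ρ
    rw [plusNormSq_smul]
    have h1 : 0 ≤ plusNormSq P y := hP.posSemidef.re_dotProduct_nonneg y
    exact (mul_le_of_le_one_left h1 (pow_le_one₀ ht0 ht1)).trans hy'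
  · change plusNormSq P 0 ≤ ρ
    rwa [plusNormSq_zero]
  · exact (PiLp.continuous_toLp 2 _).comp
      ((continuous_quadMap A v f₀).comp (continuous_const.add continuous_id))
  · intro c hc y₁ hy₁ y₂ hy₂ h₁ h₂
    have hcc : c.ofLp ⬝ᵥ c.ofLp = 1 := by
      have h := EuclideanSpace.real_norm_sq_eq c
      rw [hc] at h
      simp only [dotProduct, ← sq]
      linarith
    have hmin : ∀ y, IsMinOn
        (fun y => inner ℝ c (WithLp.toLp 2 (quadMap A v f₀ (x₀ + y)))) {y | plusNormSq P y ≤ ρ} y →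
        ∀ y', plusNormSq P y' ≤ ρ →
          plusNormSq (combMat c.ofLp A) y - 2 * RCLike.re (star y ⬝ᵥ combVec c.ofLp A v x₀) ≤
          plusNormSq (combMat c.ofLp A) y' - 2 * RCLike.re (star y' ⬝ᵥ combVec c.ofLp A v x₀) :=
      fun y hy y' hy' => by
        have h := isMinOn_iff.1 hy y' hy'
        rw [hinner, hinner] at h
        linarith
    exact eq_of_isMinOn (combMat_isHermitian hA _) hP
      (fun hlam => exists_kernel_of_hasEpsMaxSq_top hA hP hmax ⟨hcc, hlam⟩)
      hy₁ hy₂ (hmin _ h₁) (hmin _ h₂)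

end Image

end QuadImage

theorem proposition1 {𝕜 : Type*} [RCLike 𝕜] {n m : ℕ}
    (A : Fin m → Matrix (Fin n) (Fin n) 𝕜) (hA : ∀ i, (A i).IsHermitian)
    (v : Fin m → Fin n → 𝕜) (f₀ : Fin m → ℝ)
    (hmax : ∃ (x₀ : Fin n → 𝕜) (Aplus : Matrix (Fin n) (Fin n) 𝕜),
      Aplus.PosDef ∧ QuadImage.HasEpsMaxSq A v x₀ Aplus ⊤) :
    Convex ℝ (Set.range (QuadImage.quadMap A v f₀)) := by
  obtain ⟨x₀, P, hP, hmax⟩ := hmax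
  rintro _ ⟨x₁, rfl⟩ _ ⟨x₂, rfl⟩ s t hs ht hst
  -- The smallest ball around `x₀` containing both preimages.
  set ρ := max (QuadImage.plusNormSq P (x₁ - x₀)) (QuadImage.plusNormSq P (x₂ - x₀))
  have hρ : 0 ≤ ρ := le_max_of_le_left (hP.posSemidef.re_dotProduct_nonneg _)
  have h₁ : QuadImage.plusNormSq P (x₁ - x₀) ≤ ρ := le_max_left _ _
  have h₂ : QuadImage.plusNormSq P (x₂ - x₀) ≤ ρ := le_max_right _ _
  obtain ⟨y, -, hy⟩ := QuadImage.convex_image_ball hA f₀ hP hmax hρ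
    ⟨x₁ - x₀, h₁, rfl⟩ ⟨x₂ - x₀, h₂, rfl⟩ hs ht hst
  refine ⟨x₀ + y, ?_⟩
  have h := congrArg WithLp.ofLp hy
  simpa using h
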